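/- **Multidistribution Amplitude Estimation.** Let $A_1^O,\dots,A_N^O$ be $l$-qubit oracle algorithms, each making $k$ queries to a unitary oracle $O$, that is, $A_y^O = U_{k,y}\,O\,U_{k-1,y}\cdots U_{1,y}\,O\,U_{0,y}$ with $l$-qubit unitaries $U_{j,y}$ that do not depend on $O$ (and an arbitrary $l$-qubit unitary $O$). Let $\gamma^1,\dots,\gamma^N\in\{0,1\}^l$, and put $p_y = |\langle\gamma^y|A_y^O|0^l\rangle|^2$ and $S_v = I-2|v\rangle\langle v|$. For $m\ge 0$ let $\mathrm{MDistAEAlgo}$ be the following circuit on three registers: an $N$-dimensional index register, an $l$-qubit work register and an $m$-qubit output register. It performs, in this order, $\sum_y|y\rangle\langle y|\otimes A_y^O\otimes I$; the quantum Fourier transform $F_m$ on the output register; $\sum_y\sum_{b}|y\rangle\langle y|\otimes G_y^{\,b}\otimes|b\rangle\langle b|$ with $G_y=-A_y^OS_{0^l}(A_y^O)^\dagger S_{\gamma^y}$; and $F_m^{-1}$ on the output register. The third step is carried out as $2^i$ Grover iterations controlled by the output qubit of weight $2^i$, for $i=0,\dots,m-1$. The control on $y$ is pushed inside $A_y^O$,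 $(A_y^O)^\dagger$ and the Grover iterations: only the oracle-free gates $U_{j,y}$, $U_{j,y}^\dagger$, $S_{\gamma^y}$ are controlled on $y$, while every oracle gate is $O$ or $O^\dagger$ on the work register, controlled by at most one output qubit. Each such gate counts as one query to $O$. There is a universal constant $C>0$ such that the following holds for all $N,l,k$, all $U_{j,y}$ and $\gamma^y$ as above, all $0<\varepsilon\le 1$, all integers $t\ge0$, and $m=\lceil\log_2(1/\varepsilon)\rceil+t$. 1. $\mathrm{MDistAEAlgo}$ makes at most $C\,2^t\,k/\varepsilon$ queries to $O$ (so $O(k/\varepsilon)$ for fixed $t$, independently of $N$). 2. Call $b\in\{0,\dots,2^m-1\}$ *good for $y$* if $\left|\sin^2(\pi b/2^m)-p_y\right|\le C\varepsilon/2^t$ (an $O(\varepsilon)$-estimate; at most $\varepsilon/8$ for a suitable fixed $t$). For every $O$ there are, for each $y$, a real $\beta_y\in[0,1]$ with $\beta_y^2\ge 8/\pi^2$, a unit vector $|\Xi_y\rangle=\sum_{b\text{ good for }y}|\xi_{y,b}\rangle|b\rangle$ and a vector $|E_y\rangle=\sum_{b\text{ not good for }y}|e_{y,b}\rangle|b\rangle$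 with $\||E_y\rangle\|^2=1-\beta_y^2$, on the work and output registers (the $|\xi_{y,b}\rangle$, $|e_{y,b}\rangle$ need not be normalized), such that for every $\alpha$ with $\sum_y|\alpha_y|^2=1$ the circuit acts by $$\sum_y\alpha_y|y\rangle|0^l\rangle|0^m\rangle\ \longmapsto\ |\mathrm{out}\rangle=\sum_y\alpha_y|y\rangle\big(\beta_y|\Xi_y\rangle+|E_y\rangle\big).$$ In particular, with $|\Phi\rangle=\sum_y\alpha_y|y\rangle|\Xi_y\rangle$ one has $|\langle\Phi|\mathrm{out}\rangle|^2\ge 8/\pi^2$, and measuring the index and output registers of $|\mathrm{out}\rangle$ yields, with probability at least $8/\pi^2$, a pair $(y,b)$ with $b$ good for $y$. -/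

import Mathlib

/-- Computational basis labels of an `n`-qubit register. -/
abbrev Bits (n : ℕ) : Type := Fin n → Fin 2

/-- The integer in `{0, …, 2 ^ n - 1}` whose binary digits (least significant first) are `b`. -/
def Bits.val {n : ℕ} (b : Bits n) : ℕ := ∑ i : Fin n, (b i : ℕ) * 2 ^ (i : ℕ)

/-- Unitary operators on the space with orthonormal basis `ι`. -/
abbrev QOp (ι : Type) [Fintype ι] [DecidableEq ι] : Type := Matrix.unitaryGroup ι ℂ

/-- Basis labels `|y⟩|x⟩|b⟩` of the whole memory: the index register `y`, the `l`-qubit work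
register `x` on which the given algorithms run, and the `m`-qubit output register `b`. -/
abbrev Reg (N l m : ℕ) : Type := Fin N × Bits l × Bits m

/-! ### Oracle algorithms -/

/-- The `k`-query algorithm `U_k O U_{k-1} ⋯ U_1 O U_0`. -/
def queryAlg {G : Type} [Mul G] : (k : ℕ) → (Fin (k + 1) → G) → G → G
  | 0, U, _ => U 0
  | k + 1, U, O => U (Fin.last (k + 1)) * O * queryAlg k (fun j => U j.castSucc) O

/-- `|⟨γ| A |0^l⟩|²`. -/
noncomputable def goodProb {l : ℕ} (A : QOp (Bits l)) (γ : Bits l) : ℝ :=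
  ‖(A : Matrix (Bits l) (Bits l) ℂ) γ 0‖ ^ 2

/-! ### Elementary unitaries -/

/-- The reflection `I - 2 |v⟩⟨v|`. -/
noncomputable def reflection {l : ℕ} (v : Bits l) : QOp (Bits l) :=
  ⟨Matrix.diagonal (fun x => if x = v then -1 else 1), by
    rw [Matrix.mem_unitaryGroup_iff, Matrix.star_eq_conjTranspose, Matrix.diagonal_conjTranspose,
      Matrix.diagonal_mul_diagonal, ← Matrix.diagonal_one]
    congr 1
    funext x
    by_cases h : x = v <;> simp [h]⟩

/-- The block-diagonal operator `∑_{y,b} |y⟩⟨y| ⊗ f y b ⊗ |b⟩⟨b|`. -/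
noncomputable def condMatrix {N l m : ℕ} (f : Fin N → Bits m → QOp (Bits l)) :
    Matrix (Reg N l m) (Reg N l m) ℂ :=
  fun r s => if r.1 = s.1 ∧ r.2.2 = s.2.2 then
    (f r.1 r.2.2 : Matrix (Bits l) (Bits l) ℂ) r.2.1 s.2.1 else 0

theorem condMatrix_mem {N l m : ℕ} (f : Fin N → Bits m → QOp (Bits l)) :
    condMatrix f ∈ Matrix.unitaryGroup (Reg N l m) ℂ := by
  rw [Matrix.mem_unitaryGroup_iff]
  ext ⟨y, x, b⟩ ⟨y', x', b'⟩
  have h := fun y b => (Matrix.mem_unitaryGroup_iff.mp (f y b).2)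
  simp only [Matrix.mul_apply, Matrix.star_apply, condMatrix, Fintype.sum_prod_type]
  by_cases hyb : y = y' ∧ b = b'
  · obtain ⟨rfl, rfl⟩ := hyb
    have h1 := congrFun (congrFun (h y b) x) x'
    simp only [Matrix.mul_apply, Matrix.star_apply] at h1
    rw [Finset.sum_eq_single y (by intro z _ hz; simp [hz.symm]) (by simp)]
    have : ∀ z : Bits l, (∑ c : Bits m,
        (if y = y ∧ b = c then (f y b : Matrix (Bits l) (Bits l) ℂ) x z else 0) *
        star (if y = y ∧ b = c then (f y b : Matrix (Bits l) (Bits l) ℂ) x' z else 0)) =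
        (f y b : Matrix (Bits l) (Bits l) ℂ) x z *
          star ((f y b : Matrix (Bits l) (Bits l) ℂ) x' z) := by
      intro z
      rw [Finset.sum_eq_single b (by intro c _ hc; simp [hc.symm]) (by simp)]
      simp
    rw [Finset.sum_congr rfl fun z _ => this z, h1]
    simp only [Matrix.one_apply, Prod.mk.injEq, true_and, and_true]
  · rw [Matrix.one_apply_ne (by
      intro hh
      simp only [Prod.mk.injEq] at hh
      exact hyb ⟨hh.1, hh.2.2⟩)]
    refine Finset.sum_eq_zero fun z _ => Finset.sum_eq_zero fun w _ =>
      Finset.sum_eq_zero fun c _ => ?_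
    by_cases h1 : y = z ∧ b = c
    · obtain ⟨rfl, rfl⟩ := h1
      rw [if_neg (fun hh : y' = y ∧ b' = b => hyb ⟨hh.1.symm, hh.2.symm⟩)]
      simp
    · simp [h1]

/-- `∑_{y,b} |y⟩⟨y| ⊗ f y b ⊗ |b⟩⟨b|` as a unitary operator on the memory. -/
noncomputable def condOp {N l m : ℕ} (f : Fin N → Bits m → QOp (Bits l)) :
    QOp (Reg N l m) :=
  ⟨condMatrix f, condMatrix_mem f⟩

/-- `I ⊗ I ⊗ F`: a matrix `F` acting on the output register. -/
noncomputable def outMatrix {N l m : ℕ} (F : Matrix (Bits m) (Bits m) ℂ) :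
    Matrix (Reg N l m) (Reg N l m) ℂ :=
  fun r s => if r.1 = s.1 ∧ r.2.1 = s.2.1 then F r.2.2 s.2.2 else 0

theorem outMatrix_mem {N l m : ℕ} (F : QOp (Bits m)) :
    (outMatrix F : Matrix (Reg N l m) (Reg N l m) ℂ) ∈ Matrix.unitaryGroup (Reg N l m) ℂ := by
  rw [Matrix.mem_unitaryGroup_iff]
  ext ⟨y, x, b⟩ ⟨y', x', b'⟩
  have h := Matrix.mem_unitaryGroup_iff.mp F.2
  simp only [Matrix.mul_apply, Matrix.star_apply, outMatrix, Fintype.sum_prod_type]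
  by_cases hyb : y = y' ∧ x = x'
  · obtain ⟨rfl, rfl⟩ := hyb
    have h1 := congrFun (congrFun h b) b'
    simp only [Matrix.mul_apply, Matrix.star_apply] at h1
    rw [Finset.sum_eq_single y (by intro z _ hz; simp [hz.symm]) (by simp),
      Finset.sum_eq_single x (by intro z _ hz; simp [hz.symm]) (by simp)]
    simp only [and_self, if_true, h1, Matrix.one_apply, Prod.mk.injEq, true_and]
  · rw [Matrix.one_apply_ne (by
      intro hh
      simp only [Prod.mk.injEq] at hh
      exact hyb ⟨hh.1, hh.2.1⟩)]
    refine Finset.sum_eq_zero fun z _ => Finset.sum_eq_zero fun w _ =>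
      Finset.sum_eq_zero fun c _ => ?_
    by_cases h1 : y = z ∧ x = w
    · obtain ⟨rfl, rfl⟩ := h1
      rw [if_neg (fun hh : y' = y ∧ x' = x => hyb ⟨hh.1.symm, hh.2.symm⟩)]
      simp
    · simp [h1]

/-- `I ⊗ I ⊗ F` as a unitary operator on the memory. -/
noncomputable def outOp {N l m : ℕ} (F : QOp (Bits m)) : QOp (Reg N l m) :=
  ⟨outMatrix F, outMatrix_mem F⟩

/-! ### The quantum Fourier transform on `m` qubits -/

theorem Bits.val_eq {n : ℕ} (b : Bits n) : b.val = (finFunctionFinEquiv b : ℕ) := by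
  simp [Bits.val]

/-- `|c⟩ ↦ 2^{-m/2} ∑_b e^{2πi bc/2^m} |b⟩`. -/
noncomputable def fourierMatrix (m : ℕ) : Matrix (Bits m) (Bits m) ℂ :=
  fun b c => Complex.exp (2 * Real.pi * Complex.I * (b.val * c.val : ℕ) / (2 ^ m : ℕ)) /
    (Real.sqrt (2 ^ m) : ℝ)

theorem fourierMatrix_mem (m : ℕ) : fourierMatrix m ∈ Matrix.unitaryGroup (Bits m) ℂ := by
  rw [Matrix.mem_unitaryGroup_iff]
  ext b c
  have hM : (2 ^ m : ℕ) ≠ 0 := by positivity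
  have hM' : ((2 ^ m : ℕ) : ℂ) ≠ 0 := by exact_mod_cast hM
  set ζ : ℂ := Complex.exp (2 * Real.pi * Complex.I * ((b.val : ℂ) - c.val) / (2 ^ m : ℕ)) with hζ
  have key : ∀ d : Bits m, fourierMatrix m b d * star (fourierMatrix m c d) =
      ζ ^ d.val / (2 ^ m : ℕ) := by
    intro d
    have h2 : ((Real.sqrt (2 ^ m) : ℝ) : ℂ) * (Real.sqrt (2 ^ m) : ℝ) = (2 ^ m : ℕ) := by
      rw [← Complex.ofReal_mul, Real.mul_self_sqrt (by positivity)]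
      push_cast
      rfl
    have h3 : star (fourierMatrix m c d) =
        Complex.exp (-(2 * Real.pi * Complex.I * (c.val * d.val : ℕ) / (2 ^ m : ℕ))) /
          (Real.sqrt (2 ^ m) : ℝ) := by
      simp only [fourierMatrix, Complex.star_def, map_div₀, Complex.conj_ofReal,
        ← Complex.exp_conj, map_mul, map_natCast, Complex.conj_I, map_ofNat]
      congr 2
      ring
    rw [h3, fourierMatrix, div_mul_div_comm, h2, ← Complex.exp_add, hζ, ← Complex.exp_nat_mul]
    congr 2
    push_cast
    ring
  rw [Matrix.mul_apply]
  simp only [Matrix.star_apply, key]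
  rw [← Finset.sum_div]
  have hsum : ∑ d : Bits m, ζ ^ d.val = ∑ j ∈ Finset.range (2 ^ m), ζ ^ j := by
    rw [← Fin.sum_univ_eq_sum_range (fun j => ζ ^ j)]
    exact Fintype.sum_equiv finFunctionFinEquiv _ _ fun d => by rw [Bits.val_eq]
  rw [hsum]
  by_cases hbc : b = c
  · subst hbc
    have h1 : ζ = 1 := by simp [hζ]
    rw [h1, Matrix.one_apply_eq]
    simp only [one_pow, Finset.sum_const, Finset.card_range, nsmul_eq_mul, mul_one]
    exact div_self hM'
  · have hpow : ζ ^ (2 ^ m) = 1 := by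
      rw [hζ, ← Complex.exp_nat_mul, Complex.exp_eq_one_iff]
      refine ⟨(b.val : ℤ) - c.val, ?_⟩
      push_cast
      field_simp
    have hne : ζ ≠ 1 := by
      intro h1
      rw [hζ, Complex.exp_eq_one_iff] at h1
      obtain ⟨n, hn⟩ := h1
      have hpi : (2 * Real.pi * Complex.I : ℂ) ≠ 0 := by
        simp [Real.pi_ne_zero]
      have h4 : ((b.val : ℂ) - c.val) = n * (2 ^ m : ℕ) := by
        have h5 : (2 * Real.pi * Complex.I : ℂ) * ((b.val : ℂ) - c.val) =
            (2 * Real.pi * Complex.I : ℂ) * (n * (2 ^ m : ℕ)) := by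
          rw [div_eq_iff hM'] at hn
          rw [hn]
          ring
        exact mul_left_cancel₀ hpi h5
      have h6 : ((b.val : ℤ) - c.val) = n * (2 ^ m : ℕ) := by exact_mod_cast h4
      have hb : b.val < 2 ^ m := by rw [Bits.val_eq]; exact (finFunctionFinEquiv b).2
      have hc : c.val < 2 ^ m := by rw [Bits.val_eq]; exact (finFunctionFinEquiv c).2
      have h7 : ((b.val : ℤ) - c.val) = 0 := by
        refine Int.eq_zero_of_abs_lt_dvd (m := ((2 ^ m : ℕ) : ℤ)) ⟨n, by rw [h6]; ring⟩ ?_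
        rw [abs_lt]
        constructor <;> omega
      apply hbc
      apply finFunctionFinEquiv.injective
      apply Fin.ext
      rw [← Bits.val_eq, ← Bits.val_eq]
      omega
    rw [geom_sum_eq hne, hpow, Matrix.one_apply_ne hbc]
    simp

/-- The Fourier transform `F_m` as a unitary operator. -/
noncomputable def qft (m : ℕ) : QOp (Bits m) := ⟨fourierMatrix m, fourierMatrix_mem m⟩

/-! ### Query circuits -/

/-- Is the control satisfied? No control, or control on qubit `i` of the output register. -/
def ctrlOn {m : ℕ} : Option (Fin m) → Bits m → Prop
  | none, _ => True
  | some i, b => b i = 1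

instance {m : ℕ} (c : Option (Fin m)) (b : Bits m) : Decidable (ctrlOn c b) := by
  cases c <;> unfold ctrlOn <;> infer_instance

/-- A gate of a query circuit: a fixed unitary on the memory that does not involve the oracle, or
one application of the oracle or of its inverse to the work register, possibly controlled by a
qubit of the output register. -/
inductive Gate (N l m : ℕ) : Type where
  | free (U : QOp (Reg N l m)) : Gate N l m
  | query (c : Option (Fin m)) : Gate N l m
  | queryInv (c : Option (Fin m)) : Gate N l m

/-- `V y` on the work register in branch `y`, provided the control `c` is satisfied. -/
noncomputable def ctrlOp {N l m : ℕ} (c : Option (Fin m)) (V : Fin N → QOp (Bits l)) :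
    QOp (Reg N l m) :=
  condOp fun y b => if ctrlOn c b then V y else 1

/-- The unitary that a gate performs when the oracle is `O`. -/
noncomputable def Gate.eval {N l m : ℕ} (O : QOp (Bits l)) : Gate N l m → QOp (Reg N l m)
  | .free U => U
  | .query c => ctrlOp c fun _ => O
  | .queryInv c => ctrlOp c fun _ => O⁻¹

/-- The number of oracle calls of a gate. -/
def Gate.cost {N l m : ℕ} : Gate N l m → ℕ
  | .free _ => 0
  | .query _ => 1
  | .queryInv _ => 1

/-- The gate undoing a given gate. -/
noncomputable def Gate.inv {N l m : ℕ} : Gate N l m → Gate N l m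
  | .free U => .free U⁻¹
  | .query c => .queryInv c
  | .queryInv c => .query c

/-- A query circuit: its gates in the order in which they are applied. It is fixed before the
oracle is known. -/
abbrev Circuit (N l m : ℕ) : Type := List (Gate N l m)

/-- The unitary that a circuit performs when the oracle is `O`. -/
noncomputable def Circuit.eval {N l m : ℕ} (O : QOp (Bits l)) :
    Circuit N l m → QOp (Reg N l m)
  | [] => 1
  | g :: gs => Circuit.eval O gs * g.eval O

/-- The number of oracle calls of a circuit. -/
def Circuit.queries {N l m : ℕ} (C : Circuit N l m) : ℕ := (C.map Gate.cost).sum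

/-! ### The algorithm -/

section MDistAE

variable {N l m : ℕ}

/-- An oracle-free gate applying `V y` in branch `y`, under control `c`. -/
noncomputable def ctrlGate (c : Option (Fin m)) (V : Fin N → QOp (Bits l)) : Gate N l m :=
  .free (ctrlOp c V)

/-- `A_y = U_{k,y} O ⋯ O U_{0,y}` in branch `y`, under control `c`: the control on `y` is pushed
to the oracle-free unitaries `U_{j,y}`, so that each of the `k` oracle calls is shared by all the
branches. -/
noncomputable def algCircuit (c : Option (Fin m)) :
    (k : ℕ) → (Fin (k + 1) → Fin N → QOp (Bits l)) → Circuit N l m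
  | 0, U => [ctrlGate c (U 0)]
  | k + 1, U => algCircuit c k (fun j => U j.castSucc) ++
      [.query c, ctrlGate c (U (Fin.last (k + 1)))]

/-- One Grover iteration `G_y = - A_y S_0 A_y† S_{γ_y}` in branch `y`, under control `c`. -/
noncomputable def groverCircuit (c : Option (Fin m)) (k : ℕ)
    (U : Fin (k + 1) → Fin N → QOp (Bits l)) (γ : Fin N → Bits l) : Circuit N l m :=
  [ctrlGate c fun y => reflection (γ y)] ++
    (algCircuit c k U).reverse.map Gate.inv ++
    [ctrlGate c fun _ => reflection 0] ++
    algCircuit c k U ++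
    [ctrlGate c fun _ => -1]

/-- `∑_y |y⟩⟨y| ⊗ ∑_b G_y^b ⊗ |b⟩⟨b|`: for every qubit `i` of the output register, `2^i` Grover
iterations controlled by that qubit. -/
noncomputable def groverPowersCircuit (k : ℕ)
    (U : Fin (k + 1) → Fin N → QOp (Bits l)) (γ : Fin N → Bits l) : Circuit N l m :=
  (List.finRange m).flatMap fun i : Fin m =>
    (List.replicate (2 ^ (i : ℕ)) (groverCircuit (some i) k U γ)).flatten

/-- Multidistribution amplitude estimation with `m` output qubits: prepare `A_y |0^l⟩` in every
branch `y`, then estimate the phase of `G_y` in every branch. -/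
noncomputable def mDistAEAlgo (m k : ℕ)
    (U : Fin (k + 1) → Fin N → QOp (Bits l)) (γ : Fin N → Bits l) : Circuit N l m :=
  algCircuit none k U ++
    [.free (outOp (qft m))] ++
    groverPowersCircuit k U γ ++
    [.free (outOp (qft m)⁻¹)]

end MDistAE

/-! ### States -/

/-- The state `∑_y α_y |y⟩ ⊗ ψ_y`. -/
def branchState {N l m : ℕ} (α : Fin N → ℂ) (ψ : Fin N → Bits l × Bits m → ℂ) :
    Reg N l m → ℂ :=
  fun r => α r.1 * ψ r.1 r.2

/-- The basis state `|0^l⟩|0^m⟩`. -/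
def zeroState (l m : ℕ) : Bits l × Bits m → ℂ := Pi.single 0 1

/-- `b` is a `δ`-estimate of `p`: `|sin²(π b / 2^m) - p| ≤ δ`. -/
def IsEstimate {m : ℕ} (b : Bits m) (p δ : ℝ) : Prop :=
  |Real.sin (Real.pi * b.val / 2 ^ m) ^ 2 - p| ≤ δ

noncomputable instance {m : ℕ} (b : Bits m) (p δ : ℝ) : Decidable (IsEstimate b p δ) :=
  Classical.propDecidable _

/-! ### The Dirichlet kernel -/

/-! No step changes the index `y`: every gate is block diagonal in `y`, so each branch runs ordinary
amplitude estimation for its own `A = A_y` (`eval_mDistAEAlgo_mulVec`). Queries do not grow with `N`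
because an oracle gate is the same operator in all branches; the total is `k + 2k(2^m - 1)`.

In one branch write `p = sin² θ`. On the plane spanned by the good and bad parts of `A|0⟩`, the
Grover iteration is a rotation by `2θ`, so `G^b A|0⟩` has amplitudes `sin((2b+1)θ)` and
`cos((2b+1)θ)` (`groverCoeff_sin_cos`). With `M = 2^m` and `D` the Dirichlet kernel `phaseSum M`,
the inverse Fourier transform gives label `c` the probability `(|D(θ - πc/M)|² + |D(-θ - πc/M)|²) /
(2M²)` (`groverCoeff_weight`, `sum_norm_sq_estimationState`).

The two grid angles next to `θ` carry at least `8/π²` of the first kernel's weight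
(`eight_div_pi_sq_le_phaseSum`), and likewise for `-θ`. Since `sin²` is even, `π`-periodic and
1-Lipschitz, labels near either angle estimate `p` within `π/M ≤ 4ε/2^t`. Splitting each branch
state into its good and bad labels (`exists_decomposition`) gives `β_y`; the claims on the
superposition are averages over `y` with weights `|α_y|²`. -/

theorem sq_one_sub_sq_le_cos_sq_mul {w : ℝ} (h0 : 0 ≤ w) (h1 : w ≤ 1) :
    (1 - w ^ 2) ^ 2 ≤ Real.cos (Real.pi * w / 2) ^ 2 * (1 + w ^ 2) := by
  have hpi := Real.pi_gt_d2
  have hpi' := Real.pi_lt_d2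
  -- Equality holds at both `w = 0` and `w = 1`, so each end needs its own Taylor bound: `cos` at
  -- `0` here, `sin` of the complementary angle near `w = 1`.
  rcases le_total w (3 / 5) with hw | hw
  -- The factor `5/4` is an upper bound for `π²/8`.
  · have hc : 1 - (5 / 4) * w ^ 2 ≤ Real.cos (Real.pi * w / 2) := by
      refine le_trans ?_ (Real.one_sub_sq_div_two_le_cos)
      have : Real.pi ^ 2 ≤ 10 := by nlinarith
      nlinarith [sq_nonneg w]
    have hq : w ^ 2 ≤ 9 / 25 := by nlinarith
    have hc2 := pow_le_pow_left₀ (by linarith) hc 2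
    refine le_trans ?_ (mul_le_mul_of_nonneg_right hc2 (by positivity))
    -- With `q = w²`, the difference of the two sides is `q(25q² - 31q + 8)/16`, and `25(9/25 -
    -- q)(22/25 - q) = 25q² - 31q + 7.92`.
    have := mul_nonneg (sq_nonneg w)
      (mul_nonneg (sub_nonneg.2 hq) (by linarith : 0 ≤ 22 / 25 - w ^ 2))
    nlinarith
  · rcases h1.eq_or_lt with rfl | h1
    · simp
    obtain ⟨s, rfl⟩ : ∃ s, w = 1 - s := ⟨1 - w, by ring⟩
    have hs0 : 0 < s := by linarith
    have hs1 : s ≤ 2 / 5 := by linarith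
    rw [show Real.pi * (1 - s) / 2 = Real.pi / 2 - Real.pi * s / 2 by ring, Real.cos_pi_div_two_sub]
    have hx : 157 / 100 * s ≤ Real.pi * s / 2 := by nlinarith
    have hx' : Real.pi * s / 2 ≤ 79 / 50 * s := by nlinarith
    have hsin := Real.sin_gt_sub_cube (x := Real.pi * s / 2) (by positivity)
    set x := Real.pi * s / 2
    have hx2 : x ^ 2 ≤ 5 / 2 * s ^ 2 := by nlinarith
    have hlow : 157 / 100 * s * (1 - 1 / 4 * s) ≤ Real.sin x := by
      refine le_trans ?_ hsin.le
      rw [show x - x ^ 3 / 6 = x * (1 - x ^ 2 / 6) by ring]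
      exact mul_le_mul hx (by nlinarith) (by linarith) (by linarith)
    have h2 := pow_le_pow_left₀ (mul_nonneg (by positivity) (by linarith)) hlow 2
    refine le_trans ?_ (mul_le_mul_of_nonneg_right h2 (by positivity))
    -- Since `1 - w² = s(2 - s)`, this is the goal with the common factor `s²` removed.
    have : (2 - s) ^ 2 ≤ (157 / 100 * (1 - 1 / 4 * s)) ^ 2 * (1 + (1 - s) ^ 2) := by
      nlinarith [mul_nonneg hs0.le (sub_nonneg.2 hs1), sq_nonneg s,
        mul_nonneg (mul_nonneg hs0.le hs0.le) (sub_nonneg.2 hs1)]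
    have := mul_le_mul_of_nonneg_left this (sq_nonneg s)
    linarith

/-- After division by `f²(1 - f)²` this bounds `sin²(πf)(1/f² + 1/(1 - f)²)` below by `8`, the value
at `f = 1/2`, where the phase is midway between two grid points. The substitution `w = 2f - 1`
centres the inequality there. -/
theorem eight_mul_sq_le_sin_sq {f : ℝ} (h0 : 0 ≤ f) (h1 : f ≤ 1) :
    8 * (f ^ 2 * (1 - f) ^ 2) ≤ Real.sin (Real.pi * f) ^ 2 * (f ^ 2 + (1 - f) ^ 2) := by
  wlog hf : 1 / 2 ≤ f generalizing f
  · have := this (f := 1 - f) (by linarith) (by linarith) (by linarith)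
    rw [show Real.pi * (1 - f) = Real.pi - Real.pi * f by ring, Real.sin_pi_sub] at this
    linarith
  have := sq_one_sub_sq_le_cos_sq_mul (w := 2 * f - 1) (by linarith) (by linarith)
  rw [show Real.pi * (2 * f - 1) / 2 = Real.pi * f - Real.pi / 2 by ring,
    Real.cos_sub_pi_div_two] at this
  linarith

/-- The Dirichlet kernel `∑_{b < M} e^{2ibφ}`. -/
noncomputable def phaseSum (M : ℕ) (φ : ℝ) : ℂ :=
  ∑ b ∈ Finset.range M, Complex.exp (2 * φ * Complex.I) ^ b

theorem phaseSum_add_int_mul_pi (M : ℕ) (φ : ℝ) (z : ℤ) :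
    phaseSum M (φ + z * Real.pi) = phaseSum M φ := by
  unfold phaseSum
  have : Complex.exp (2 * (φ + z * Real.pi : ℝ) * Complex.I) = Complex.exp (2 * φ * Complex.I) := by
    rw [Complex.exp_eq_exp_iff_exists_int]
    exact ⟨z, by push_cast; ring⟩
  rw [this]

theorem phaseSum_zero (M : ℕ) : phaseSum M 0 = M := by simp [phaseSum]

theorem norm_exp_two_mul_I_sub_one (φ : ℝ) :
    ‖Complex.exp (2 * φ * Complex.I) - 1‖ = 2 * |Real.sin φ| := by
  have := Complex.norm_exp_I_mul_ofReal_sub_one (2 * φ)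
  rw [show Complex.I * ((2 * φ : ℝ) : ℂ) = 2 * φ * Complex.I by push_cast; ring] at this
  rw [this, mul_div_cancel_left₀ _ two_ne_zero, norm_mul]
  simp

/-- The geometric sum gives `|sin(Mφ)| = |D(φ)| |sin φ|`, and `|sin φ| ≤ |φ|`. The product form
remains valid at zeros of `sin φ`. -/
theorem abs_sin_le_norm_phaseSum_mul (M : ℕ) (φ : ℝ) :
    |Real.sin (M * φ)| ≤ ‖phaseSum M φ‖ * |φ| := by
  have h := geom_sum_mul (Complex.exp (2 * φ * Complex.I)) M
  have h2 : Complex.exp (2 * φ * Complex.I) ^ M =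
      Complex.exp (2 * (M * φ : ℝ) * Complex.I) := by
    rw [← Complex.exp_nat_mul]; congr 1; push_cast; ring
  rw [h2] at h
  have h3 := congrArg norm h
  rw [norm_mul, norm_exp_two_mul_I_sub_one, norm_exp_two_mul_I_sub_one] at h3
  have : |Real.sin (M * φ)| = ‖phaseSum M φ‖ * |Real.sin φ| := by
    unfold phaseSum; linarith
  rw [this]
  exact mul_le_mul_of_nonneg_left (Real.abs_sin_le_abs) (norm_nonneg _)

/-- The two multiples of `π / M` around `θ` carry weight `8 / π²` of the Dirichlet kernel. -/
theorem eight_div_pi_sq_le_phaseSum (M : ℕ) (hM : 0 < M) (θ : ℝ) (n : ℤ)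
    (hn : (n : ℝ) ≤ θ * M / Real.pi) (hn' : θ * M / Real.pi < n + 1) :
    8 / Real.pi ^ 2 * M ^ 2 ≤ ‖phaseSum M (θ - Real.pi * n / M)‖ ^ 2 +
      ‖phaseSum M (θ - Real.pi * (n + 1 : ℤ) / M)‖ ^ 2 := by
  have hM' : (0 : ℝ) < M := by exact_mod_cast hM
  have hpi := Real.pi_pos
  -- `f` is the offset of `θ` from the lower grid angle, in units of `π/M`; the upper one is at
  -- offset `1 - f`.
  obtain ⟨f, hf⟩ : ∃ f, f = θ * M / Real.pi - n := ⟨_, rfl⟩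
  have h0 : 0 ≤ f := by linarith
  have h1 : f < 1 := by linarith
  have e0 : θ - Real.pi * n / M = Real.pi * f / M := by rw [hf]; field_simp
  have e1 : θ - Real.pi * (n + 1 : ℤ) / M = -(Real.pi * (1 - f) / M) := by
    rw [hf]; push_cast; field_simp; ring
  rw [e0, e1]
  have s0 := abs_sin_le_norm_phaseSum_mul M (Real.pi * f / M)
  have s1 := abs_sin_le_norm_phaseSum_mul M (-(Real.pi * (1 - f) / M))
  -- If `θ` lies on the grid, the first kernel alone has full weight `M²`; this case is separated
  -- because `f` is a denominator below.
  rcases h0.eq_or_lt with rfl | hf0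
  · have : phaseSum M (Real.pi * 0 / M) = M := by simp [phaseSum_zero]
    rw [this]
    have h8 : 8 / Real.pi ^ 2 ≤ 1 := by
      rw [div_le_one (by positivity)]; nlinarith [Real.pi_gt_three]
    simp only [Complex.norm_natCast]
    nlinarith [sq_nonneg ‖phaseSum M (-(Real.pi * (1 - 0) / M))‖, sq_nonneg (M : ℝ)]
  set P := ‖phaseSum M (Real.pi * f / M)‖
  set Q := ‖phaseSum M (-(Real.pi * (1 - f) / M))‖
  rw [mul_div_cancel₀ _ hM'.ne', abs_of_nonneg (a := Real.pi * f / M) (by positivity)] at s0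
  have hf1 : 0 < 1 - f := by linarith
  rw [mul_neg, mul_div_cancel₀ _ hM'.ne', abs_neg,
    abs_of_nonneg (a := Real.pi * (1 - f) / M) (by positivity), Real.sin_neg, abs_neg,
    show Real.pi * (1 - f) = Real.pi - Real.pi * f by ring, Real.sin_pi_sub,
    show Real.pi - Real.pi * f = Real.pi * (1 - f) by ring] at s1
  have t0 := pow_le_pow_left₀ (abs_nonneg _) s0 2
  have t1 := pow_le_pow_left₀ (abs_nonneg _) s1 2
  rw [sq_abs] at t0 t1
  have key := eight_mul_sq_le_sin_sq h0 h1.le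
  have u0 : Real.sin (Real.pi * f) ^ 2 * M ^ 2 / (Real.pi ^ 2 * f ^ 2) ≤ P ^ 2 := by
    rw [div_le_iff₀ (by positivity)]
    calc _ ≤ (P * (Real.pi * f / M)) ^ 2 * M ^ 2 := by gcongr
      _ = _ := by field_simp
  have u1 : Real.sin (Real.pi * f) ^ 2 * M ^ 2 / (Real.pi ^ 2 * (1 - f) ^ 2) ≤ Q ^ 2 := by
    rw [div_le_iff₀ (by positivity)]
    calc _ ≤ (Q * (Real.pi * (1 - f) / M)) ^ 2 * M ^ 2 := by gcongr
      _ = _ := by field_simp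
  refine le_trans ?_ (add_le_add u0 u1)
  have : Real.sin (Real.pi * f) ^ 2 * M ^ 2 / (Real.pi ^ 2 * f ^ 2) +
      Real.sin (Real.pi * f) ^ 2 * M ^ 2 / (Real.pi ^ 2 * (1 - f) ^ 2) =
      M ^ 2 / Real.pi ^ 2 * ((Real.sin (Real.pi * f) ^ 2 * (f ^ 2 + (1 - f) ^ 2)) /
        (f ^ 2 * (1 - f) ^ 2)) := by
    field_simp; ring
  rw [this, show 8 / Real.pi ^ 2 * (M : ℝ) ^ 2 = M ^ 2 / Real.pi ^ 2 * 8 by ring]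
  gcongr
  rw [le_div_iff₀ (by positivity)]
  exact key

/-! ### Grid angles modulo `π` -/

theorem Bits.exists_val_eq {m n : ℕ} (h : n < 2 ^ m) : ∃ b : Bits m, b.val = n :=
  ⟨finFunctionFinEquiv.symm ⟨n, h⟩, by rw [Bits.val_eq]; simp⟩

theorem Bits.exists_int_val_eq (m : ℕ) (n : ℤ) :
    ∃ (b : Bits m) (z : ℤ), (b.val : ℤ) + z * (2 ^ m : ℕ) = n := by
  have hM : (0 : ℤ) < (2 ^ m : ℕ) := by positivity
  obtain ⟨b, hb⟩ := Bits.exists_val_eq (m := m) (n := (n % (2 ^ m : ℕ)).toNat) (by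
    have := Int.emod_lt_of_pos n hM
    have := Int.emod_nonneg n hM.ne'
    omega)
  refine ⟨b, n / (2 ^ m : ℕ), ?_⟩
  rw [hb, Int.toNat_of_nonneg (Int.emod_nonneg n hM.ne'), mul_comm]
  exact Int.emod_add_mul_ediv n _

/-- The two grid neighbours of `θ` have arbitrary integer indices; reducing these modulo `2^m` gives
labels and shifts the angle by a multiple of `π`, which the kernel does not see. Hence closeness in
`hS` is measured modulo `π`. -/
theorem eight_div_pi_sq_le_sum_phaseSum (m : ℕ) (θ : ℝ) (S : Finset (Bits m))
    (hS : ∀ (b : Bits m) (z : ℤ),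
      |θ - Real.pi * b.val / (2 ^ m : ℕ) - z * Real.pi| ≤ Real.pi / (2 ^ m : ℕ) → b ∈ S) :
    8 / Real.pi ^ 2 * ((2 ^ m : ℕ) : ℝ) ^ 2 ≤
      ∑ b ∈ S, ‖phaseSum (2 ^ m) (θ - Real.pi * b.val / (2 ^ m : ℕ))‖ ^ 2 := by
  have hM : 0 < 2 ^ m := by positivity
  generalize hMM : 2 ^ m = M at *
  have hM' : (0 : ℝ) < M := by exact_mod_cast hM
  have hpi := Real.pi_pos
  have hn := Int.floor_le (θ * M / Real.pi)
  have hn' := Int.lt_floor_add_one (θ * M / Real.pi)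
  have key := eight_div_pi_sq_le_phaseSum M hM θ _ hn hn'
  set n := ⌊θ * M / Real.pi⌋
  obtain ⟨b, z, hb⟩ := Bits.exists_int_val_eq m n
  obtain ⟨c, w, hc⟩ := Bits.exists_int_val_eq m (n + 1)
  rw [hMM] at hb hc
  have hbR : (n : ℝ) = b.val + z * M := by exact_mod_cast hb.symm
  have hcR : ((n + 1 : ℤ) : ℝ) = c.val + w * M := by exact_mod_cast hc.symm
  have eb : θ - Real.pi * b.val / M = θ - Real.pi * n / M + z * Real.pi := by
    rw [hbR]; field_simp; ring
  have ec : θ - Real.pi * c.val / M = θ - Real.pi * (n + 1 : ℤ) / M + w * Real.pi := by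
    rw [hcR]; field_simp; ring
  rw [le_div_iff₀ hpi] at hn
  rw [div_lt_iff₀ hpi] at hn'
  have hbS : b ∈ S := hS b z (by
    rw [eb, add_sub_cancel_right, abs_le]
    constructor
    · rw [show -(Real.pi / M) = -Real.pi / M by ring, div_le_iff₀ hM', sub_mul,
        div_mul_cancel₀ _ hM'.ne']
      nlinarith
    · rw [le_div_iff₀ hM', sub_mul, div_mul_cancel₀ _ hM'.ne']
      nlinarith)
  have hcS : c ∈ S := hS c w (by
    rw [ec, add_sub_cancel_right, abs_le]
    push_cast
    constructor
    · rw [show -(Real.pi / M) = -Real.pi / M by ring, div_le_iff₀ hM', sub_mul,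
        div_mul_cancel₀ _ hM'.ne']
      nlinarith
    · rw [le_div_iff₀ hM', sub_mul, div_mul_cancel₀ _ hM'.ne']
      nlinarith)
  have nonneg : ∀ x ∈ S, 0 ≤ ‖phaseSum M (θ - Real.pi * x.val / M)‖ ^ 2 := fun _ _ => by positivity
  rw [← phaseSum_add_int_mul_pi M (θ - Real.pi * n / M) z, ← eb,
    ← phaseSum_add_int_mul_pi M (θ - Real.pi * (n + 1 : ℤ) / M) w, ← ec] at key
  -- Consecutive indices give the same label only for `M = 1`, where the kernel is identically `1`.
  by_cases hbc : b = c
  · have h1 : M = 1 := by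
      subst hbc
      have h2 : (w - z) * (M : ℤ) = 1 := by linarith
      have := Int.eq_one_or_neg_one_of_mul_eq_one' h2
      omega
    refine le_trans ?_ (Finset.single_le_sum nonneg hbS)
    have : phaseSum M (θ - Real.pi * b.val / M) = 1 := by rw [h1]; simp [phaseSum]
    rw [this, h1]
    have h8 : 8 / Real.pi ^ 2 ≤ 1 := by
      rw [div_le_one (by positivity)]; nlinarith [Real.pi_gt_three]
    simpa using h8
  · refine key.trans ?_
    rw [← Finset.sum_pair (f := fun x : Bits m =>
      ‖phaseSum M (θ - Real.pi * x.val / M)‖ ^ 2) hbc]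
    refine Finset.sum_le_sum_of_subset_of_nonneg ?_ fun x hx _ => nonneg x hx
    intro x hx
    rcases Finset.mem_insert.mp hx with rfl | hx
    · exact hbS
    · rw [Finset.mem_singleton.mp hx]; exact hcS

theorem abs_sin_sq_sub_sin_sq_le (x y : ℝ) : |Real.sin x ^ 2 - Real.sin y ^ 2| ≤ |x - y| := by
  have : Real.sin x ^ 2 - Real.sin y ^ 2 = Real.sin (x + y) * Real.sin (x - y) := by
    rw [Real.sin_add, Real.sin_sub]
    nlinarith [Real.sin_sq_add_cos_sq x, Real.sin_sq_add_cos_sq y]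
  rw [this, abs_mul]
  calc _ ≤ 1 * |x - y| := mul_le_mul (Real.abs_sin_le_one _) Real.abs_sin_le_abs (abs_nonneg _)
        zero_le_one
    _ = _ := one_mul _

/-! ### Amplitudes of Grover iterates -/

/-- Coefficients of the `b`-th Grover iterate along the good and the bad part of the initial
state with success probability `p`. -/
def groverCoeff (p : ℝ) : ℕ → ℝ × ℝ
  | 0 => (1, 1)
  | b + 1 =>
    let a := groverCoeff p b
    (2 * (a.2 * (1 - p) - a.1 * p) + a.1, 2 * (a.2 * (1 - p) - a.1 * p) - a.2)

/-- The recursion is the addition theorem for a rotation by `2θ`. Coefficients are taken relative to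
the parts of `A|0⟩`, and multiplied by `sin θ` and `cos θ` only here, so `p = 0` and `p = 1` are not
special. -/
theorem groverCoeff_sin_cos (θ : ℝ) (b : ℕ) :
    (groverCoeff (Real.sin θ ^ 2) b).1 * Real.sin θ = Real.sin (2 * b * θ + θ) ∧
      (groverCoeff (Real.sin θ ^ 2) b).2 * Real.cos θ = Real.cos (2 * b * θ + θ) := by
  induction b with
  | zero => simp [groverCoeff]
  | succ b ih =>
    obtain ⟨h1, h2⟩ := ih
    have e : 2 * ((b + 1 : ℕ) : ℝ) * θ + θ = (2 * b * θ + θ) + (θ + θ) := by push_cast; ring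
    have hs := Real.sin_sq_add_cos_sq θ
    rw [e, Real.sin_add (2 * b * θ + θ), Real.cos_add (2 * b * θ + θ), ← h1, ← h2, Real.sin_add,
      Real.cos_add]
    have hp : 1 - Real.sin θ ^ 2 = Real.cos θ ^ 2 := by linarith
    simp only [groverCoeff, hp]
    set a := groverCoeff (Real.sin θ ^ 2) b
    constructor
    · linear_combination (a.1 * Real.sin θ) * (-hs)
    · linear_combination (a.2 * Real.cos θ) * (hs)

/-- By Euler's formulas the good and bad amplitudes are `(Q - P)i/2` and `(P + Q)/2`, where `P` and
`Q` are the kernels at `θ - χ` and `-θ - χ` up to unimodular factors. The parallelogram law removes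
the cross terms. -/
theorem groverCoeff_weight (M : ℕ) (θ χ : ℝ) :
    ‖∑ b ∈ Finset.range M, Complex.exp (-(2 * χ * Complex.I)) ^ b *
        (groverCoeff (Real.sin θ ^ 2) b).1‖ ^ 2 * Real.sin θ ^ 2 +
      ‖∑ b ∈ Finset.range M, Complex.exp (-(2 * χ * Complex.I)) ^ b *
        (groverCoeff (Real.sin θ ^ 2) b).2‖ ^ 2 * (1 - Real.sin θ ^ 2) =
    (‖phaseSum M (θ - χ)‖ ^ 2 + ‖phaseSum M (-θ - χ)‖ ^ 2) / 2 := by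
  set e := Complex.exp (-(2 * χ * Complex.I)) with he
  set P := Complex.exp (θ * Complex.I) * phaseSum M (θ - χ) with hP
  set Q := Complex.exp (-(θ * Complex.I)) * phaseSum M (-θ - χ) with hQ
  have nP : ‖phaseSum M (θ - χ)‖ = ‖P‖ := by
    rw [hP, norm_mul, Complex.norm_exp_ofReal_mul_I, one_mul]
  have nQ : ‖phaseSum M (-θ - χ)‖ = ‖Q‖ := by
    rw [hQ, norm_mul, ← neg_mul, ← Complex.ofReal_neg, Complex.norm_exp_ofReal_mul_I, one_mul]
  have termP : ∀ b : ℕ, Complex.exp (θ * Complex.I) *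
      Complex.exp (2 * ((θ - χ : ℝ) : ℂ) * Complex.I) ^ b =
      e ^ b * Complex.exp ((2 * b * θ + θ : ℂ) * Complex.I) := by
    intro b
    rw [he, ← Complex.exp_nat_mul, ← Complex.exp_nat_mul, ← Complex.exp_add, ← Complex.exp_add]
    congr 1; push_cast; ring
  have termQ : ∀ b : ℕ, Complex.exp (-(θ * Complex.I)) *
      Complex.exp (2 * ((-θ - χ : ℝ) : ℂ) * Complex.I) ^ b =
      e ^ b * Complex.exp (-(2 * b * θ + θ : ℂ) * Complex.I) := by
    intro b
    rw [he, ← Complex.exp_nat_mul, ← Complex.exp_nat_mul, ← Complex.exp_add, ← Complex.exp_add]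
    congr 1; push_cast; ring
  have hS : (∑ b ∈ Finset.range M, e ^ b * (groverCoeff (Real.sin θ ^ 2) b).1) *
      (Real.sin θ : ℂ) = (Q - P) * Complex.I / 2 := by
    rw [hP, hQ, phaseSum, phaseSum, Finset.mul_sum, Finset.mul_sum, ← Finset.sum_sub_distrib,
      Finset.sum_mul, Finset.sum_mul, Finset.sum_div]
    refine Finset.sum_congr rfl fun b _ => ?_
    rw [termP, termQ, mul_assoc, ← Complex.ofReal_mul, (groverCoeff_sin_cos θ b).1]
    push_cast
    rw [Complex.sin]
    ring
  have hK : (∑ b ∈ Finset.range M, e ^ b * (groverCoeff (Real.sin θ ^ 2) b).2) *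
      (Real.cos θ : ℂ) = (P + Q) / 2 := by
    rw [hP, hQ, phaseSum, phaseSum, Finset.mul_sum, Finset.mul_sum, ← Finset.sum_add_distrib,
      Finset.sum_mul, Finset.sum_div]
    refine Finset.sum_congr rfl fun b _ => ?_
    rw [termP, termQ, mul_assoc, ← Complex.ofReal_mul, (groverCoeff_sin_cos θ b).2]
    push_cast
    rw [Complex.cos]
    ring
  have hp : 1 - Real.sin θ ^ 2 = Real.cos θ ^ 2 := by linarith [Real.sin_sq_add_cos_sq θ]
  have hs : ∀ (z : ℂ) (r : ℝ), ‖z‖ ^ 2 * r ^ 2 = ‖z * (r : ℂ)‖ ^ 2 := by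
    intro z r; rw [norm_mul, mul_pow, Complex.norm_real, Real.norm_eq_abs, sq_abs]
  rw [nP, nQ, hs, hp, hs, hS, hK]
  have par := parallelogram_law_with_norm ℝ P Q
  simp only [norm_div, norm_mul, Complex.norm_I, Complex.norm_ofNat, mul_one]
  rw [norm_sub_rev Q P]
  linarith

/-! ### Evaluation of circuits -/

theorem condOp_mul {N l m : ℕ} (f g : Fin N → Bits m → QOp (Bits l)) :
    condOp f * condOp g = condOp fun y b => f y b * g y b := by
  apply Subtype.ext
  ext ⟨y, x, b⟩ ⟨y', x', b'⟩
  simp only [condOp, Matrix.UnitaryGroup.mul_val, Matrix.mul_apply, condMatrix,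
    Fintype.sum_prod_type]
  rw [Finset.sum_eq_single y (by intro z _ hz; simp [hz.symm]) (by simp)]
  have : ∀ z : Bits l, (∑ c : Bits m,
      (if y = y ∧ b = c then (f y b : Matrix (Bits l) (Bits l) ℂ) x z else 0) *
        (if y = y' ∧ c = b' then (g y c : Matrix (Bits l) (Bits l) ℂ) z x' else 0)) =
      if y = y' ∧ b = b' then (f y b : Matrix (Bits l) (Bits l) ℂ) x z *
        (g y b : Matrix (Bits l) (Bits l) ℂ) z x' else 0 := by
    intro z
    rw [Finset.sum_eq_single b (by intro c _ hc; simp [hc.symm]) (by simp)]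
    simp
  rw [Finset.sum_congr rfl fun z _ => this z]
  split_ifs <;> simp

theorem condOp_one {N l m : ℕ} : condOp (fun (_ : Fin N) (_ : Bits m) => (1 : QOp (Bits l))) = 1 :=
  mul_eq_left (a := condOp fun (_ : Fin N) (_ : Bits m) => (1 : QOp (Bits l))) |>.mp
    (by rw [condOp_mul]; simp)

theorem condOp_inv {N l m : ℕ} (f : Fin N → Bits m → QOp (Bits l)) :
    (condOp f)⁻¹ = condOp fun y b => (f y b)⁻¹ :=
  inv_eq_of_mul_eq_one_right (by rw [condOp_mul]; simp [condOp_one])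

theorem ctrlOp_mul {N l m : ℕ} (c : Option (Fin m)) (V W : Fin N → QOp (Bits l)) :
    ctrlOp c V * ctrlOp c W = ctrlOp c fun y => V y * W y := by
  rw [ctrlOp, ctrlOp, condOp_mul, ctrlOp]
  congr 1; funext y b; split_ifs <;> simp

theorem ctrlOp_inv {N l m : ℕ} (c : Option (Fin m)) (V : Fin N → QOp (Bits l)) :
    (ctrlOp c V)⁻¹ = ctrlOp c fun y => (V y)⁻¹ := by
  rw [ctrlOp, condOp_inv, ctrlOp]
  congr 1; funext y b; split_ifs <;> simp

theorem ctrlOp_one {N l m : ℕ} (c : Option (Fin m)) :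
    ctrlOp c (fun _ : Fin N => (1 : QOp (Bits l))) = 1 := by
  rw [ctrlOp, ← condOp_one]
  congr 1; funext y b; split_ifs <;> simp

theorem ctrlOp_pow {N l m : ℕ} (c : Option (Fin m)) (V : Fin N → QOp (Bits l)) (n : ℕ) :
    ctrlOp c V ^ n = ctrlOp c fun y => V y ^ n := by
  induction n with
  | zero => simp [ctrlOp_one]
  | succ n ih => rw [pow_succ, ih, ctrlOp_mul]; simp only [pow_succ]

section Evaluation

variable {N l m : ℕ}

theorem Circuit.eval_append (O : QOp (Bits l)) (C D : Circuit N l m) :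
    Circuit.eval O (C ++ D) = Circuit.eval O D * Circuit.eval O C := by
  induction C with
  | nil => simp [Circuit.eval]
  | cons g C ih => rw [List.cons_append, Circuit.eval, Circuit.eval, ih, mul_assoc]

theorem Circuit.eval_singleton (O : QOp (Bits l)) (g : Gate N l m) :
    Circuit.eval O [g] = g.eval O := by simp [Circuit.eval]

theorem Gate.eval_inv (O : QOp (Bits l)) (g : Gate N l m) : g.inv.eval O = (g.eval O)⁻¹ := by
  cases g <;> simp [Gate.inv, Gate.eval, ctrlOp_inv]

theorem Circuit.eval_inv (O : QOp (Bits l)) (C : Circuit N l m) :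
    Circuit.eval O (C.reverse.map Gate.inv) = (Circuit.eval O C)⁻¹ := by
  induction C with
  | nil => simp [Circuit.eval]
  | cons g C ih =>
    rw [List.reverse_cons, List.map_append, Circuit.eval_append, ih, List.map_singleton,
      Circuit.eval_singleton, Gate.eval_inv, Circuit.eval, mul_inv_rev]

theorem Circuit.eval_flatten_replicate (O : QOp (Bits l)) (C : Circuit N l m) (n : ℕ) :
    Circuit.eval O (List.replicate n C).flatten = Circuit.eval O C ^ n := by
  induction n with
  | zero => simp [Circuit.eval]
  | succ n ih => rw [List.replicate_succ, List.flatten_cons, Circuit.eval_append, ih, pow_succ]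

theorem eval_ctrlGate (O : QOp (Bits l)) (c : Option (Fin m)) (V : Fin N → QOp (Bits l)) :
    (ctrlGate c V).eval O = ctrlOp c V := rfl

/-- A query is the branch-independent case of `ctrlOp`, so one oracle gate serves as the factor `O`
in all branches at once. -/
theorem eval_algCircuit (O : QOp (Bits l)) (c : Option (Fin m)) (k : ℕ)
    (U : Fin (k + 1) → Fin N → QOp (Bits l)) :
    Circuit.eval O (algCircuit c k U) = ctrlOp c fun y => queryAlg k (fun j => U j y) O := by
  induction k with
  | zero => rw [algCircuit, Circuit.eval_singleton, eval_ctrlGate]; rfl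
  | succ k ih =>
    rw [algCircuit, Circuit.eval_append, ih, Circuit.eval, Circuit.eval_singleton, eval_ctrlGate,
      Gate.eval, ctrlOp_mul, ctrlOp_mul]
    rfl

/-- The Grover iteration `-A S_0 A† S_γ`. -/
noncomputable def groverOp (A : QOp (Bits l)) (γ : Bits l) : QOp (Bits l) :=
  -1 * (A * (reflection 0 * (A⁻¹ * reflection γ)))

theorem eval_groverCircuit (O : QOp (Bits l)) (c : Option (Fin m)) (k : ℕ)
    (U : Fin (k + 1) → Fin N → QOp (Bits l)) (γ : Fin N → Bits l) :
    Circuit.eval O (groverCircuit c k U γ) =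
      ctrlOp c fun y => groverOp (queryAlg k (fun j => U j y) O) (γ y) := by
  simp only [groverCircuit, Circuit.eval_append, Circuit.eval_singleton, Circuit.eval_inv,
    eval_algCircuit, eval_ctrlGate, ctrlOp_inv, ctrlOp_mul, groverOp]

/-- Qubit `i` contributes the exponent `2^i` exactly when it is `1`; the exponents add up to the
binary value of `b`. -/
theorem eval_groverPowersCircuit (O : QOp (Bits l)) (k : ℕ)
    (U : Fin (k + 1) → Fin N → QOp (Bits l)) (γ : Fin N → Bits l) :
    Circuit.eval O (groverPowersCircuit (m := m) k U γ) =
      condOp fun y b => groverOp (queryAlg k (fun j => U j y) O) (γ y) ^ b.val := by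
  -- The claim is generalised to an arbitrary list of control qubits to permit induction.
  have key : ∀ L : List (Fin m), Circuit.eval O (L.flatMap fun i : Fin m =>
      (List.replicate (2 ^ (i : ℕ)) (groverCircuit (some i) k U γ)).flatten) =
      condOp fun y (b : Bits m) => groverOp (queryAlg k (fun j => U j y) O) (γ y) ^
        (L.map fun i => (b i : ℕ) * 2 ^ (i : ℕ)).sum := by
    intro L
    induction L with
    | nil => simp [Circuit.eval, condOp_one]
    | cons i L ih =>
      rw [List.flatMap_cons, Circuit.eval_append, ih, Circuit.eval_flatten_replicate,
        eval_groverCircuit, ctrlOp_pow, ctrlOp, condOp_mul]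
      congr 1; funext y b
      rw [List.map_cons, List.sum_cons]
      generalize groverOp _ _ = G
      rw [add_comm, pow_add]
      congr 1
      simp only [ctrlOn]
      split_ifs with h
      · simp [h]
      · have : b i = 0 := by omega
        simp [this]
  rw [groverPowersCircuit, key]
  simp only [Bits.val, Fin.sum_univ_def]

theorem eval_mDistAEAlgo (O : QOp (Bits l)) (k : ℕ)
    (U : Fin (k + 1) → Fin N → QOp (Bits l)) (γ : Fin N → Bits l) :
    Circuit.eval O (mDistAEAlgo m k U γ) =
      outOp (qft m)⁻¹ * ((condOp fun y b =>
        groverOp (queryAlg k (fun j => U j y) O) (γ y) ^ b.val) *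
      (outOp (qft m) * condOp fun y _ => queryAlg k (fun j => U j y) O)) := by
  simp only [mDistAEAlgo, Circuit.eval_append, Circuit.eval_singleton, eval_algCircuit,
    eval_groverPowersCircuit, Gate.eval, ctrlOp, ctrlOn]
  rfl

/-! ### Counting queries -/

theorem Circuit.queries_append (C D : Circuit N l m) :
    (C ++ D).queries = C.queries + D.queries := by simp [Circuit.queries]

theorem Circuit.queries_inv (C : Circuit N l m) :
    Circuit.queries (C.reverse.map Gate.inv) = C.queries := by
  have : (Gate.cost ∘ Gate.inv : Gate N l m → ℕ) = Gate.cost := by funext g; cases g <;> rfl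
  simp [Circuit.queries, this, List.sum_reverse]

theorem queries_algCircuit (c : Option (Fin m)) (k : ℕ)
    (U : Fin (k + 1) → Fin N → QOp (Bits l)) : (algCircuit c k U).queries = k := by
  induction k with
  | zero => rfl
  | succ k ih => rw [algCircuit, Circuit.queries_append, ih]; rfl

theorem queries_groverCircuit (c : Option (Fin m)) (k : ℕ)
    (U : Fin (k + 1) → Fin N → QOp (Bits l)) (γ : Fin N → Bits l) :
    (groverCircuit c k U γ).queries = 2 * k := by
  have : ∀ V : Fin N → QOp (Bits l), Circuit.queries [ctrlGate c V] = 0 := fun _ => rfl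
  simp only [groverCircuit, Circuit.queries_append, Circuit.queries_inv, queries_algCircuit, this]
  ring

theorem queries_groverPowersCircuit (k : ℕ)
    (U : Fin (k + 1) → Fin N → QOp (Bits l)) (γ : Fin N → Bits l) :
    (groverPowersCircuit (m := m) k U γ).queries = (2 ^ m - 1) * (2 * k) := by
  have rep : ∀ (n : ℕ) (C : Circuit N l m),
      Circuit.queries (List.replicate n C).flatten = n * C.queries := by
    intro n C
    induction n with
    | zero => simp [Circuit.queries]
    | succ n ih =>
      rw [List.replicate_succ, List.flatten_cons, Circuit.queries_append, ih]; ring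
  have key : ∀ L : List (Fin m), Circuit.queries (L.flatMap fun i : Fin m =>
      (List.replicate (2 ^ (i : ℕ)) (groverCircuit (some i) k U γ)).flatten) =
      (L.map fun i : Fin m => 2 ^ (i : ℕ)).sum * (2 * k) := by
    intro L
    induction L with
    | nil => simp [Circuit.queries]
    | cons i L ih =>
      rw [List.flatMap_cons, Circuit.queries_append, ih, rep, queries_groverCircuit, List.map_cons,
        List.sum_cons]
      ring
  rw [groverPowersCircuit, key, ← Fin.sum_univ_def, Fin.sum_univ_eq_sum_range (fun i => 2 ^ i),
    Nat.geomSum_eq le_rfl]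
  simp

theorem queries_mDistAEAlgo_le (k : ℕ)
    (U : Fin (k + 1) → Fin N → QOp (Bits l)) (γ : Fin N → Bits l) :
    (mDistAEAlgo m k U γ).queries ≤ 2 * 2 ^ m * k := by
  have : ∀ V : QOp (Reg N l m), Circuit.queries [Gate.free V] = 0 := fun _ => rfl
  simp only [mDistAEAlgo, Circuit.queries_append, queries_algCircuit, queries_groverPowersCircuit,
    this]
  -- This removes the truncated subtraction in `2^m - 1`.
  obtain ⟨n, hn⟩ : ∃ n, 2 ^ m = n + 1 := ⟨2 ^ m - 1, (Nat.sub_add_cancel Nat.one_le_two_pow).symm⟩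
  rw [hn, Nat.add_sub_cancel]
  nlinarith

/-! ### The state produced by the algorithm -/

theorem condOp_mulVec (f : Fin N → Bits m → QOp (Bits l)) (α : Fin N → ℂ)
    (ψ : Fin N → Bits l × Bits m → ℂ) :
    Matrix.mulVec (condOp f : Matrix (Reg N l m) (Reg N l m) ℂ) (branchState α ψ) =
      branchState α fun y q =>
        Matrix.mulVec (f y q.2 : Matrix (Bits l) (Bits l) ℂ) (fun x => ψ y (x, q.2)) q.1 := by
  funext ⟨y, x, b⟩
  simp only [Matrix.mulVec, dotProduct, condOp, condMatrix, branchState, Fintype.sum_prod_type]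
  rw [Finset.sum_eq_single y (by intro z _ hz; simp [hz.symm]) (by simp), Finset.mul_sum]
  refine Finset.sum_congr rfl fun z _ => ?_
  rw [Finset.sum_eq_single b (by intro c _ hc; simp [hc.symm]) (by simp)]
  simp only [and_self, if_true]
  ring

theorem outOp_mulVec (F : QOp (Bits m)) (α : Fin N → ℂ) (ψ : Fin N → Bits l × Bits m → ℂ) :
    Matrix.mulVec ((outOp F : QOp (Reg N l m)) : Matrix (Reg N l m) (Reg N l m) ℂ) (branchState α ψ) =
      branchState α fun y q =>
        Matrix.mulVec (F : Matrix (Bits m) (Bits m) ℂ) (fun b => ψ y (q.1, b)) q.2 := by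
  funext ⟨y, x, b⟩
  simp only [Matrix.mulVec, dotProduct, outOp, outMatrix, branchState, Fintype.sum_prod_type]
  rw [Finset.sum_eq_single y (by intro z _ hz; simp [hz.symm]) (by simp),
    Finset.sum_eq_single x (by intro z _ hz; simp [hz.symm]) (by simp), Finset.mul_sum]
  refine Finset.sum_congr rfl fun z _ => ?_
  simp only [and_self, if_true]
  ring

theorem sum_norm_sq_mulVec {ι : Type} [Fintype ι] [DecidableEq ι] (U : QOp ι) (v : ι → ℂ) :
    ∑ i, ‖Matrix.mulVec (U : Matrix ι ι ℂ) v i‖ ^ 2 = ∑ i, ‖v i‖ ^ 2 := by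
  have norm_eq : ∀ w : ι → ℂ, ((∑ i, ‖w i‖ ^ 2 : ℝ) : ℂ) = star w ⬝ᵥ w := by
    intro w
    simp only [dotProduct, Pi.star_apply, Complex.star_def, Complex.conj_mul']
    push_cast; rfl
  apply Complex.ofReal_injective
  rw [norm_eq, norm_eq, Matrix.star_mulVec, Matrix.dotProduct_mulVec, Matrix.vecMul_vecMul,
    ← Matrix.star_eq_conjTranspose, Matrix.UnitaryGroup.star_mul_self, Matrix.vecMul_one]

theorem sum_norm_sq_col {ι : Type} [Fintype ι] [DecidableEq ι] (U : QOp ι) (j : ι) :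
    ∑ i, ‖(U : Matrix ι ι ℂ) i j‖ ^ 2 = 1 := by
  have := sum_norm_sq_mulVec U (Pi.single j 1)
  rw [Matrix.mulVec_single_one] at this
  simp only [Matrix.col_apply] at this
  rw [this, Finset.sum_eq_single j (by intro b _ hb; simp [hb]) (by simp)]
  simp

/-- Conjugating `S_0` by `A` gives `I - 2|ψ⟩⟨ψ|` with `ψ = A|0⟩`, so `G = (2|ψ⟩⟨ψ| - I) S_γ`. -/
theorem groverOp_apply (A : QOp (Bits l)) (γ x z : Bits l) :
    (groverOp A γ : Matrix (Bits l) (Bits l) ℂ) x z =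
      (2 * ((A : Matrix (Bits l) (Bits l) ℂ) x 0 * star ((A : Matrix (Bits l) (Bits l) ℂ) z 0)) -
        (1 : Matrix (Bits l) (Bits l) ℂ) x z) * if z = γ then -1 else 1 := by
  set a : Matrix (Bits l) (Bits l) ℂ := (A : Matrix (Bits l) (Bits l) ℂ) with ha
  have hA : ∑ w, a x w * star (a z w) = (1 : Matrix (Bits l) (Bits l) ℂ) x z := by
    rw [← Matrix.mem_unitaryGroup_iff.mp A.2, Matrix.mul_apply]; rfl
  have h : (groverOp A γ : Matrix (Bits l) (Bits l) ℂ) =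
      -((a * Matrix.diagonal (fun x : Bits l => if x = 0 then -1 else 1) * star a) *
        Matrix.diagonal (fun x : Bits l => if x = γ then -1 else 1)) := by
    simp only [groverOp, reflection, neg_mul, one_mul, mul_assoc]
    rfl
  have h2 : (a * Matrix.diagonal (fun x : Bits l => if x = 0 then -1 else 1) * star a :
      Matrix (Bits l) (Bits l) ℂ) x z =
      (1 : Matrix (Bits l) (Bits l) ℂ) x z - 2 * (a x 0 * star (a z 0)) := by
    rw [Matrix.mul_apply]
    simp only [Matrix.mul_diagonal, Matrix.star_apply]
    rw [← hA, ← Finset.add_sum_erase _ _ (Finset.mem_univ (0 : Bits l)),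
      ← Finset.add_sum_erase (a := (0 : Bits l)) _ (fun w => a x w * star (a z w))
        (Finset.mem_univ _),
      Finset.sum_congr rfl (g := fun w => a x w * star (a z w)) fun w hw => by
        rw [if_neg (Finset.ne_of_mem_erase hw), mul_one]]
    simp only [if_true]
    ring
  rw [h, Matrix.neg_apply, Matrix.mul_diagonal, h2]
  ring

/-- The vector `A|0⟩` with its good part scaled by `a.1` and its bad part scaled by `a.2`. -/
noncomputable def scaledState (A : QOp (Bits l)) (γ : Bits l) (a : ℝ × ℝ) (x : Bits l) : ℂ :=
  ((if x = γ then a.1 else a.2 : ℝ) : ℂ) * (A : Matrix (Bits l) (Bits l) ℂ) x 0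

/-- Used twice: with weights `-a.1`, `a.2` it is the overlap of `A|0⟩` with a reflected scaled
state, and with squared moduli as weights it is the probability of an output label. -/
theorem sum_ite_mul_norm_sq (A : QOp (Bits l)) (γ : Bits l) (r s : ℝ) :
    ∑ x, (if x = γ then r else s) * ‖(A : Matrix (Bits l) (Bits l) ℂ) x 0‖ ^ 2 =
      r * goodProb A γ + s * (1 - goodProb A γ) := by
  have h := sum_norm_sq_col A 0
  rw [← Finset.add_sum_erase _ _ (Finset.mem_univ γ)] at h ⊢
  rw [Finset.sum_congr rfl (g := fun x => s * ‖(A : Matrix (Bits l) (Bits l) ℂ) x 0‖ ^ 2)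
    fun x hx => by rw [if_neg (Finset.ne_of_mem_erase hx)], ← Finset.mul_sum, if_pos rfl, goodProb,
    ← h]
  ring

theorem goodProb_le_one (A : QOp (Bits l)) (γ : Bits l) : goodProb A γ ≤ 1 := by
  rw [← sum_norm_sq_col A 0]
  exact Finset.single_le_sum (f := fun x => ‖(A : Matrix (Bits l) (Bits l) ℂ) x 0‖ ^ 2)
    (fun _ _ => by positivity) (Finset.mem_univ γ)

/-- `S_γ` negates `a.1`; the overlap with `A|0⟩` is then `a.2(1 - p) - a.1 p`, and reflecting about
`A|0⟩` produces the recursion of `groverCoeff`. -/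
theorem groverOp_mulVec_scaledState (A : QOp (Bits l)) (γ : Bits l) (b : ℕ) :
    Matrix.mulVec (groverOp A γ : Matrix (Bits l) (Bits l) ℂ)
        (scaledState A γ (groverCoeff (goodProb A γ) b)) =
      scaledState A γ (groverCoeff (goodProb A γ) (b + 1)) := by
  funext x
  set a := groverCoeff (goodProb A γ) b with ha
  have hsum := congrArg (fun r : ℝ => (r : ℂ)) (sum_ite_mul_norm_sq A γ (-a.1) a.2)
  push_cast at hsum
  have h : ∀ z, (groverOp A γ : Matrix (Bits l) (Bits l) ℂ) x z * scaledState A γ a z =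
      2 * (A : Matrix (Bits l) (Bits l) ℂ) x 0 * ((((if z = γ then -a.1 else a.2 : ℝ) : ℂ)) *
        (‖(A : Matrix (Bits l) (Bits l) ℂ) z 0‖ : ℂ) ^ 2) -
      (1 : Matrix (Bits l) (Bits l) ℂ) x z * ((((if z = γ then -a.1 else a.2 : ℝ) : ℂ)) *
        (A : Matrix (Bits l) (Bits l) ℂ) z 0) := by
    intro z
    rw [groverOp_apply, ← Complex.conj_mul', scaledState, Complex.star_def]
    split_ifs <;> push_cast <;> ring
  rw [Matrix.mulVec, dotProduct, Finset.sum_congr rfl fun z _ => h z, Finset.sum_sub_distrib,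
    ← Finset.mul_sum, Finset.sum_eq_single x
      (f := fun z => (1 : Matrix (Bits l) (Bits l) ℂ) x z * _)
      (by intro z _ hz; simp [Matrix.one_apply_ne hz.symm]) (by simp), Matrix.one_apply_eq]
  rw [hsum, scaledState, groverCoeff, ← ha]
  split_ifs <;> push_cast <;> ring

theorem groverOp_pow_mulVec (A : QOp (Bits l)) (γ : Bits l) (b : ℕ) :
    Matrix.mulVec ((groverOp A γ ^ b : QOp (Bits l)) : Matrix (Bits l) (Bits l) ℂ)
        (fun x => (A : Matrix (Bits l) (Bits l) ℂ) x 0) =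
      scaledState A γ (groverCoeff (goodProb A γ) b) := by
  induction b with
  | zero =>
    funext x
    simp [scaledState, groverCoeff]
  | succ b ih =>
    rw [pow_succ', Matrix.UnitaryGroup.mul_val, ← Matrix.mulVec_mulVec, ih,
      groverOp_mulVec_scaledState]

/-- The state of the work and output registers after amplitude estimation of `A`. -/
noncomputable def estimationState (A : QOp (Bits l)) (γ : Bits l) (q : Bits l × Bits m) : ℂ :=
  (∑ b ∈ Finset.range (2 ^ m),
    Complex.exp (-(2 * (Real.pi * q.2.val / (2 ^ m : ℕ) : ℝ) * Complex.I)) ^ b *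
      scaledState A γ (groverCoeff (goodProb A γ) b) q.1) / (2 ^ m : ℕ)

theorem Bits.sum_val {M : Type*} [AddCommMonoid M] (f : ℕ → M) :
    ∑ b : Bits m, f b.val = ∑ j ∈ Finset.range (2 ^ m), f j := by
  rw [← Fin.sum_univ_eq_sum_range]
  exact Fintype.sum_equiv finFunctionFinEquiv _ _ fun d => by rw [Bits.val_eq]

theorem Bits.val_zero : (0 : Bits m).val = 0 := by simp [Bits.val]

theorem eval_mDistAEAlgo_mulVec (O : QOp (Bits l)) (k : ℕ)
    (U : Fin (k + 1) → Fin N → QOp (Bits l)) (γ : Fin N → Bits l) (α : Fin N → ℂ) :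
    Matrix.mulVec ((mDistAEAlgo m k U γ).eval O : Matrix (Reg N l m) (Reg N l m) ℂ)
        (branchState α fun _ => zeroState l m) =
      branchState α fun y => estimationState (queryAlg k (fun j => U j y) O) (γ y) := by
  rw [eval_mDistAEAlgo]
  simp only [Matrix.UnitaryGroup.mul_val, ← Matrix.mulVec_mulVec, condOp_mulVec, outOp_mulVec]
  congr 1
  funext y ⟨x, c⟩
  set A := queryAlg k (fun j => U j y) O
  -- The state is followed gate by gate: `A|0⟩` is prepared, the Fourier transform makes the output
  -- register uniform, and the label `b` selects `G^b`. The inverse transform is `hF` below.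
  have h1 : ∀ (x : Bits l) (b : Bits m), Matrix.mulVec (A : Matrix (Bits l) (Bits l) ℂ)
      (fun x' => zeroState l m (x', b)) x =
      if b = 0 then (A : Matrix (Bits l) (Bits l) ℂ) x 0 else 0 := by
    intro x b
    rw [Matrix.mulVec, dotProduct,
      Finset.sum_eq_single 0 (by
        intro z _ hz
        rw [zeroState, Pi.single_eq_of_ne (by simp [Prod.ext_iff, hz]), mul_zero]) (by simp)]
    by_cases hb : b = 0
    · subst hb; simp [zeroState, Pi.single_apply]
    · simp [zeroState, hb, Prod.ext_iff]
  have h2 : ∀ (x : Bits l) (b : Bits m), Matrix.mulVec (qft m : Matrix (Bits m) (Bits m) ℂ)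
      (fun b' => if b' = 0 then (A : Matrix (Bits l) (Bits l) ℂ) x 0 else 0) b =
      ((Real.sqrt (2 ^ m) : ℝ) : ℂ)⁻¹ * (A : Matrix (Bits l) (Bits l) ℂ) x 0 := by
    intro x b
    rw [Matrix.mulVec, dotProduct,
      Finset.sum_eq_single 0 (by intro z _ hz; simp [hz]) (by simp), if_pos rfl, qft]
    simp [fourierMatrix, Bits.val_zero]
  have h3 : ∀ (b : Bits m), Matrix.mulVec
      ((groverOp A (γ y) ^ b.val : QOp (Bits l)) : Matrix (Bits l) (Bits l) ℂ)
      (fun x' => ((Real.sqrt (2 ^ m) : ℝ) : ℂ)⁻¹ * (A : Matrix (Bits l) (Bits l) ℂ) x' 0) x =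
      ((Real.sqrt (2 ^ m) : ℝ) : ℂ)⁻¹ *
        scaledState A (γ y) (groverCoeff (goodProb A (γ y)) b.val) x := by
    intro b
    rw [← groverOp_pow_mulVec, ← smul_eq_mul, ← Pi.smul_apply, ← Matrix.mulVec_smul]
    rfl
  simp only [h1, h2, h3]
  have hs : ((Real.sqrt (2 ^ m) : ℝ) : ℂ) * (Real.sqrt (2 ^ m) : ℝ) = (2 ^ m : ℕ) := by
    rw [← Complex.ofReal_mul, Real.mul_self_sqrt (by positivity)]
    push_cast
    rfl
  rw [estimationState, ← Bits.sum_val (fun b =>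
    Complex.exp (-(2 * (Real.pi * c.val / (2 ^ m : ℕ) : ℝ) * Complex.I)) ^ b *
      scaledState A (γ y) (groverCoeff (goodProb A (γ y)) b) x), Finset.sum_div, Matrix.mulVec,
    dotProduct]
  refine Finset.sum_congr rfl fun b _ => ?_
  have hF : (((qft m)⁻¹ : QOp (Bits m)) : Matrix (Bits m) (Bits m) ℂ) c b =
      Complex.exp (-(2 * (Real.pi * c.val / (2 ^ m : ℕ) : ℝ) * Complex.I)) ^ b.val *
        ((Real.sqrt (2 ^ m) : ℝ) : ℂ)⁻¹ := by
    rw [Matrix.UnitaryGroup.inv_val, Matrix.star_apply, qft]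
    simp only [fourierMatrix, Complex.star_def, map_div₀, Complex.conj_ofReal,
      ← Complex.exp_conj, map_mul, map_natCast, Complex.conj_I, map_ofNat, ← Complex.exp_nat_mul]
    rw [div_eq_mul_inv]
    congr 2
    push_cast
    ring
  rw [hF, ← hs, div_eq_mul_inv _ (_ * _), mul_inv]
  ring

/-! ### Success probability in one branch -/

theorem sum_norm_sq_estimationState (A : QOp (Bits l)) (γ : Bits l) (θ : ℝ)
    (hθ : goodProb A γ = Real.sin θ ^ 2) (c : Bits m) :
    ∑ x, ‖estimationState A γ (x, c)‖ ^ 2 =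
      (‖phaseSum (2 ^ m) (θ - Real.pi * c.val / (2 ^ m : ℕ))‖ ^ 2 +
        ‖phaseSum (2 ^ m) (-θ - Real.pi * c.val / (2 ^ m : ℕ))‖ ^ 2) / 2 /
        ((2 ^ m : ℕ) : ℝ) ^ 2 := by
  rw [← groverCoeff_weight, ← hθ, ← sum_ite_mul_norm_sq, Finset.sum_div]
  refine Finset.sum_congr rfl fun x _ => ?_
  have : ∀ b : ℕ, scaledState A γ (groverCoeff (goodProb A γ) b) x =
    ((if x = γ then (groverCoeff (goodProb A γ) b).1 else (groverCoeff (goodProb A γ) b).2 : ℝ) : ℂ)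
      * (A : Matrix (Bits l) (Bits l) ℂ) x 0 := fun _ => rfl
  simp only [estimationState, this, ← mul_assoc, ← Finset.sum_mul, norm_div, norm_mul, div_pow,
    mul_pow, Complex.norm_natCast]
  split_ifs <;> rfl

/-- No kernel has to be summed: the state is the output of a unitary circuit, namely the algorithm
with one branch, no queries and `A` as its only free gate. -/
theorem sum_norm_sq_estimationState_eq_one (A : QOp (Bits l)) (γ : Bits l) :
    ∑ q : Bits l × Bits m, ‖estimationState A γ q‖ ^ 2 = 1 := by
  have h := sum_norm_sq_mulVec
    ((mDistAEAlgo m 0 (fun (_ : Fin 1) (_ : Fin 1) => A) (fun _ => γ)).eval 1)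
    (branchState (fun _ => 1) fun _ => zeroState l m)
  rw [eval_mDistAEAlgo_mulVec] at h
  simp only [branchState, one_mul, Fintype.sum_prod_type (α₁ := Fin 1), Finset.univ_unique, Finset.sum_singleton] at h
  refine h.trans ?_
  rw [Finset.sum_eq_single 0 (by intro q _ hq; simp [zeroState, hq]) (by simp)]
  simp [zeroState]

/-- The angles `θ` and `-θ` have the same `sin²`, so labels near either are estimates of `p`. Each
kernel places a fraction `8/π²` of its weight on them, hence so does their average. -/
theorem eight_div_pi_sq_le_prob_isEstimate (A : QOp (Bits l)) (γ : Bits l) (δ : ℝ)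
    (hδ : Real.pi / (2 ^ m : ℕ) ≤ δ) :
    8 / Real.pi ^ 2 ≤ ∑ q : Bits l × Bits m with IsEstimate q.2 (goodProb A γ) δ,
      ‖estimationState A γ q‖ ^ 2 := by
  obtain ⟨θ, hθ⟩ : ∃ θ : ℝ, goodProb A γ = Real.sin θ ^ 2 := by
    refine ⟨Real.arcsin (Real.sqrt (goodProb A γ)), ?_⟩
    have h0 : 0 ≤ goodProb A γ := sq_nonneg _
    rw [Real.sin_arcsin (by linarith [Real.sqrt_nonneg (goodProb A γ)])
      (Real.sqrt_le_one.mpr (goodProb_le_one A γ)), Real.sq_sqrt h0]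
  set S : Finset (Bits m) := Finset.univ.filter fun c => IsEstimate c (goodProb A γ) δ with hS
  have hset : (Finset.univ.filter fun q : Bits l × Bits m => IsEstimate q.2 (goodProb A γ) δ) =
      Finset.univ ×ˢ S := by
    ext q; simp [hS]
  rw [hset, Finset.sum_product_right]
  simp only [sum_norm_sq_estimationState A γ θ hθ]
  rw [← Finset.sum_div, ← Finset.sum_div, Finset.sum_add_distrib, div_div,
    le_div_iff₀ (by positivity)]
  have good : ∀ φ : ℝ, Real.sin φ ^ 2 = Real.sin θ ^ 2 → ∀ (b : Bits m) (z : ℤ),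
      |φ - Real.pi * b.val / (2 ^ m : ℕ) - z * Real.pi| ≤ Real.pi / (2 ^ m : ℕ) → b ∈ S := by
    intro φ hφ b z hb
    rw [hS, Finset.mem_filter]
    refine ⟨Finset.mem_univ _, ?_⟩
    rw [IsEstimate, hθ, ← hφ, abs_sub_comm]
    -- Since `sin²` has period `π`, the shift by `z` costs nothing.
    have hper : Real.sin φ ^ 2 = Real.sin (φ - z * Real.pi) ^ 2 := by
      rw [Real.sin_sub_int_mul_pi, mul_pow, ← sq_abs ((-1 : ℝ) ^ z), abs_zpow]
      simp
    rw [hper]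
    refine (abs_sin_sq_sub_sin_sq_le _ _).trans (le_trans ?_ (hb.trans hδ))
    apply le_of_eq
    congr 1
    push_cast
    ring
  have h1 := eight_div_pi_sq_le_sum_phaseSum m θ S (good θ rfl)
  have h2 := eight_div_pi_sq_le_sum_phaseSum m (-θ) S (good (-θ) (by rw [Real.sin_neg, neg_sq]))
  linarith

end Evaluation

/-! ### Size of the output register, splitting of the state, and the main theorem -/

theorem two_pow_ceil_logb_add_bounds {ε : ℝ} (h0 : 0 < ε) (h1 : ε ≤ 1) (t : ℕ) :
    2 ^ t / ε ≤ (2 : ℝ) ^ (⌈Real.logb 2 (1 / ε)⌉₊ + t) ∧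
      (2 : ℝ) ^ (⌈Real.logb 2 (1 / ε)⌉₊ + t) ≤ 2 * (2 ^ t / ε) := by
  have hinv : 0 < 1 / ε := by positivity
  -- This is where `ε ≤ 1` matters: the logarithm is nonnegative, so the natural-number ceiling is
  -- less than one above it.
  have hlog : 0 ≤ Real.logb 2 (1 / ε) :=
    Real.logb_nonneg one_lt_two (by rw [le_div_iff₀ h0]; linarith)
  have hpow : (2 : ℝ) ^ Real.logb 2 (1 / ε) = 1 / ε :=
    Real.rpow_logb two_pos (by norm_num) hinv
  have lo : 1 / ε ≤ (2 : ℝ) ^ ⌈Real.logb 2 (1 / ε)⌉₊ := by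
    rw [← hpow, ← Real.rpow_natCast]
    exact Real.rpow_le_rpow_of_exponent_le one_le_two (by rw [hpow]; exact Nat.le_ceil _)
  have hi : (2 : ℝ) ^ ⌈Real.logb 2 (1 / ε)⌉₊ ≤ 2 * (1 / ε) := by
    rw [← hpow, ← Real.rpow_natCast, ← Real.rpow_one_add' two_pos.le (by linarith)]
    exact Real.rpow_le_rpow_of_exponent_le one_le_two
      (by rw [hpow]; linarith [Nat.ceil_lt_add_one hlog])
  have ht : (0 : ℝ) < 2 ^ t := by positivity
  rw [pow_add]
  constructor
  · calc (2 : ℝ) ^ t / ε = 1 / ε * 2 ^ t := by ring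
      _ ≤ _ := by gcongr
  · calc _ ≤ 2 * (1 / ε) * 2 ^ t := by gcongr
      _ = _ := by ring

/-- Restrict `w` to the good and to the remaining indices. The good part has positive norm because
`r > 0`, so it can be normalised, and `β` is that norm. The last clause keeps `β²` as the
probability of a good outcome. -/
theorem exists_decomposition {ι : Type*} [Fintype ι] (w : ι → ℂ) (hw : ∑ q, ‖w q‖ ^ 2 = 1)
    (good : ι → Prop) [DecidablePred good] {r : ℝ} (hr : 0 < r)
    (h : r ≤ ∑ q with good q, ‖w q‖ ^ 2) :
    ∃ (β : ℝ) (ξ η : ι → ℂ), (0 ≤ β ∧ β ≤ 1 ∧ r ≤ β ^ 2) ∧ ∑ q, ‖ξ q‖ ^ 2 = 1 ∧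
      ∑ q, ‖η q‖ ^ 2 = 1 - β ^ 2 ∧ (∀ q, ξ q ≠ 0 → good q) ∧ (∀ q, η q ≠ 0 → ¬ good q) ∧
      w = (fun q => β * ξ q + η q) ∧ β ^ 2 = ∑ q with good q, ‖w q‖ ^ 2 := by
  set P := ∑ q with good q, ‖w q‖ ^ 2 with hP
  have hP0 : 0 < P := hr.trans_le h
  have split := Finset.sum_filter_add_sum_filter_not Finset.univ good fun q => ‖w q‖ ^ 2
  rw [hw, ← hP] at split
  have hβ : 0 < Real.sqrt P := Real.sqrt_pos.mpr hP0
  have hβ2 : Real.sqrt P ^ 2 = P := Real.sq_sqrt hP0.le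
  have hP1 : P ≤ 1 := by
    have : 0 ≤ ∑ q with ¬ good q, ‖w q‖ ^ 2 := Finset.sum_nonneg fun _ _ => by positivity
    linarith
  refine ⟨Real.sqrt P, fun q => if good q then w q / Real.sqrt P else 0,
    fun q => if good q then 0 else w q, ⟨hβ.le, Real.sqrt_le_one.mpr hP1, by rw [hβ2]; exact h⟩,
    ?_, ?_, ?_, ?_, ?_, hβ2⟩
  · have : ∀ q, ‖if good q then w q / (Real.sqrt P : ℂ) else 0‖ ^ 2 =
        if good q then ‖w q‖ ^ 2 / P else 0 := by
      intro q
      split_ifs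
      · rw [norm_div, div_pow, Complex.norm_real, Real.norm_eq_abs, sq_abs, hβ2]
      · simp
    rw [Finset.sum_congr rfl fun q _ => this q, ← Finset.sum_filter, ← Finset.sum_div, ← hP,
      div_self hP0.ne']
  · have : ∀ q, ‖if good q then 0 else w q‖ ^ 2 = if ¬ good q then ‖w q‖ ^ 2 else 0 := by
      intro q
      by_cases hq : good q <;> simp [hq]
    rw [Finset.sum_congr rfl fun q _ => this q, ← Finset.sum_filter, hβ2]
    linarith
  · intro q hq
    by_contra hn
    simp [hn] at hq
  · intro q hq hn
    simp [hn] at hq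
  · funext q
    have : (Real.sqrt P : ℂ) ≠ 0 := by exact_mod_cast hβ.ne'
    by_cases hq : good q <;> simp [hq, mul_div_cancel₀, this]

theorem mainTheorem4 :
    ∃ C : ℝ, 0 < C ∧
      ∀ (N l k : ℕ) (U : Fin (k + 1) → Fin N → QOp (Bits l)) (γ : Fin N → Bits l)
        (ε : ℝ), 0 < ε → ε ≤ 1 → ∀ (t m : ℕ), m = ⌈Real.logb 2 (1 / ε)⌉₊ + t →
        (((mDistAEAlgo m k U γ).queries : ℝ) ≤ C * 2 ^ t * (k / ε)) ∧
        ∀ O : QOp (Bits l),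
          let p : Fin N → ℝ := fun y => goodProb (queryAlg k (fun j => U j y) O) (γ y)
          let δ : ℝ := C * ε / 2 ^ t
          ∃ (β : Fin N → ℝ) (ξ η : Fin N → Bits l × Bits m → ℂ),
            (∀ y, 0 ≤ β y ∧ β y ≤ 1 ∧ 8 / Real.pi ^ 2 ≤ β y ^ 2) ∧
            (∀ y, ∑ q, ‖ξ y q‖ ^ 2 = 1) ∧
            (∀ y, ∑ q, ‖η y q‖ ^ 2 = 1 - β y ^ 2) ∧
            (∀ y x b, ξ y (x, b) ≠ 0 → IsEstimate b (p y) δ) ∧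
            (∀ y x b, η y (x, b) ≠ 0 → ¬ IsEstimate b (p y) δ) ∧
            ∀ α : Fin N → ℂ, ∑ y, ‖α y‖ ^ 2 = 1 →
              let out : Reg N l m → ℂ := Matrix.mulVec
                ((mDistAEAlgo m k U γ).eval O : Matrix (Reg N l m) (Reg N l m) ℂ)
                (branchState α fun _ => zeroState l m)
              out = branchState α (fun y q => β y * ξ y q + η y q) ∧
              8 / Real.pi ^ 2 ≤ ‖star (branchState α ξ) ⬝ᵥ out‖ ^ 2 ∧
              8 / Real.pi ^ 2 ≤
                ∑ r : Reg N l m with IsEstimate r.2.2 (p r.1) δ, ‖out r‖ ^ 2 := by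
  -- `C = 4` serves twice: the query bound `2 · 2^m k` with `2^m ≤ 2 · 2^t/ε` gives the factor `4`,
  -- and the precision needs `π ≤ 4`.
  refine ⟨4, by norm_num, fun N l k U γ ε h0 h1 t m hm => ?_⟩
  obtain ⟨hlo, hhi⟩ := two_pow_ceil_logb_add_bounds h0 h1 t
  rw [← hm] at hlo hhi
  have hq : (0 : ℝ) < 8 / Real.pi ^ 2 := by positivity
  refine ⟨?_, fun O => ?_⟩
  · have : ((mDistAEAlgo m k U γ).queries : ℝ) ≤ 2 * 2 ^ m * k := by
      exact_mod_cast queries_mDistAEAlgo_le (m := m) k U γ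
    refine this.trans ?_
    calc 2 * (2 : ℝ) ^ m * k ≤ 2 * (2 * (2 ^ t / ε)) * k := by gcongr
      _ = _ := by ring
  · intro p δ
    have hδ : Real.pi / (2 ^ m : ℕ) ≤ δ := by
      have hM : (0 : ℝ) < 2 ^ m := by positivity
      rw [div_le_iff₀ h0] at hlo
      push_cast
      rw [div_le_iff₀ hM, show δ * 2 ^ m = 4 * ((2 ^ m * ε) / 2 ^ t) by simp only [δ]; ring]
      have : 1 ≤ (2 : ℝ) ^ m * ε / 2 ^ t := by rwa [one_le_div (by positivity)]
      linarith [Real.pi_le_four]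
    choose β ξ η h1 h2 h3 h4 h5 h6 h7 using fun y => exists_decomposition
      (estimationState (m := m) (queryAlg k (fun j => U j y) O) (γ y))
      (sum_norm_sq_estimationState_eq_one _ _) (fun q => IsEstimate q.2 (p y) δ) hq
      (eight_div_pi_sq_le_prob_isEstimate _ _ δ hδ)
    refine ⟨β, ξ, η, h1, h2, h3, fun y x b => h4 y (x, b), fun y x b => h5 y (x, b),
      fun α hα => ?_⟩
    intro out
    have hout : out = branchState α (fun y q => β y * ξ y q + η y q) := by
      rw [show out = _ from eval_mDistAEAlgo_mulVec O k U γ α]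
      congr 1
      funext y
      exact h6 y
    refine ⟨hout, ?_, ?_⟩
    · have inner : star (branchState α ξ) ⬝ᵥ out = ((∑ y, ‖α y‖ ^ 2 * β y : ℝ) : ℂ) := by
        rw [hout, dotProduct, Fintype.sum_prod_type]
        push_cast
        refine Finset.sum_congr rfl fun y _ => ?_
        have hξ : ∑ q, (‖ξ y q‖ : ℂ) ^ 2 = 1 := by exact_mod_cast h2 y
        rw [← mul_one ((‖α y‖ : ℂ) ^ 2 * β y), ← hξ, Finset.mul_sum]
        refine Finset.sum_congr rfl fun q _ => ?_
        -- The supports are disjoint: `ξ` lives on good labels and `η` on the others.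
        have : star (ξ y q) * η y q = 0 := by
          by_contra hne
          exact h5 y q (right_ne_zero_of_mul hne)
            (h4 y q fun h => left_ne_zero_of_mul hne (by rw [h, star_zero]))
        simp only [Pi.star_apply, branchState, star_mul', ← Complex.conj_mul', ← Complex.star_def]
        linear_combination (star (α y) * α y) * this
      -- The overlap is an average of the `β y` with weights `|α_y|²`, so it inherits their common
      -- lower bound before squaring.
      have hs : Real.sqrt (8 / Real.pi ^ 2) ≤ ∑ y, ‖α y‖ ^ 2 * β y := by
        calc _ = ∑ y, ‖α y‖ ^ 2 * Real.sqrt (8 / Real.pi ^ 2) := by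
              rw [← Finset.sum_mul, hα, one_mul]
          _ ≤ _ := Finset.sum_le_sum fun y _ => by
              gcongr
              exact Real.sqrt_le_iff.mpr ⟨(h1 y).1, (h1 y).2.2⟩
      rw [inner, Complex.norm_real, Real.norm_eq_abs, sq_abs]
      exact (Real.sqrt_le_iff.mp hs).2
    · have : ∑ r : Reg N l m with IsEstimate r.2.2 (p r.1) δ, ‖out r‖ ^ 2 =
          ∑ y, ‖α y‖ ^ 2 * β y ^ 2 := by
        rw [show out = _ from eval_mDistAEAlgo_mulVec O k U γ α, Finset.sum_filter,
          Fintype.sum_prod_type]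
        refine Finset.sum_congr rfl fun y _ => ?_
        rw [h7, ← Finset.sum_filter, Finset.mul_sum]
        refine Finset.sum_congr rfl fun q _ => ?_
        rw [branchState, norm_mul, mul_pow]
      rw [this]
      calc _ = ∑ y, ‖α y‖ ^ 2 * (8 / Real.pi ^ 2) := by rw [← Finset.sum_mul, hα, one_mul]
        _ ≤ _ := Finset.sum_le_sum fun y _ => by
            gcongr
            exact (h1 y).2.2
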